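/- Let $(\mathcal Y,d_0)$ be a metric space with $\operatorname{diam}\mathcal Y\le 1$, equipped with a $\sigma$-algebra containing the open sets, and let $\zeta=\{\zeta_n\}_{n\ge 0}$ be a stationary sequence of $\mathcal Y$-valued random variables on a probability space $(\Omega_0,\mathcal F_0,P_0)$. Assume that $\zeta$ is stretched exponentially $\alpha$-mixing: there are constants $C,b,\gamma>0$ such that for all $n,k\ge 1$, all $A\in\sigma\{\zeta_1,\dots,\zeta_k\}$ and all $B\in\sigma\{\zeta_i:\ i\ge k+n\}$, $$|P_0(A\cap B)-P_0(A)P_0(B)|\le C e^{-bn^{\gamma}}.$$ Let $\Omega=\mathcal Y^{\mathbb Z}$ with the product $\sigma$-algebra and the metric $d(x,y)=\sum_{m\in\mathbb Z}2^{-|m|}d_0(x_m,y_m)$, let $\theta$ be the shift $(\theta\omega)_m=\omega_{m+1}$, and let $P$ be a probability measure on $\Omega$ such that for all $N\ge 0$ and all measurable $A_i\subset\mathcal Y$, $$P\{y:\ y_i\in A_i,\ |i|\le N\}=P_0(\zeta_i\in A_{i-N},\ 0\le i\le 2N).$$ Let $n_0\ge 1$, let $a=(a_0,\dots,a_{n_0-1})\in\mathcal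 Y^{n_0}$, and let $\omega_0=(\dots,a,a,a,\dots)\in\Omega$, that is, $(\omega_0)_m=a_{m \bmod n_0}$. Suppose that for every $s\ge 1$ and all open sets $A_{i,j}\subset\mathcal Y$ with $a_i\in A_{i,j}$ ($0\le i<n_0$, $1\le j\le s$), $$P_0\big(\zeta_{i+(j-1)n_0}\in A_{i,j};\ 0\le i<n_0,\ 1\le j\le s\big)>0.$$ Then for every integer $s\ge 1$ and all neighbourhoods $B_{j}$ of $\theta^j\omega_0$, $0\le j<n_0$ (extended $n_0$-periodically in the index), the set $B_{\omega_0,n_0,s}=\bigcap_{i=0}^{sn_0-1}\theta^{-i}B_{i}$ has the following property: there is a constant $c>0$, and for every $\beta>0$ a constant $d_\beta>0$, such that for all $n\ge 1$, $$P\Big\{\omega:\ \sum_{j=0}^{n-1}\mathbb I_{B_{\omega_0,n_0,s}}(\theta^j\omega)\le cn\Big\}\le\frac{d_\beta}{n^{\beta}}.$$ The constants $c$ and $d_\beta$ may depend on the law of the process, on $a$, $n_0$, $s$ and on the neighbourhoods; $d_\beta$ may also depend on $\beta$, whereas $c$ does not. (For a non-measurable neighbourhood, $P$ stands for the outer measure.)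 -/

import Mathlib

open MeasureTheory

noncomputable section

/-- The left shift on two-sided sequences, `(θ ω)_m = ω_{m+1}`. -/
def biShift {Y : Type*} (ω : ℤ → Y) : ℤ → Y := fun m => ω (m + 1)

/-- The two-sided periodic sequence obtained by repeating the word `a = (a_0, …, a_{n₀-1})`,
with `a_0` in place `0`: its `m`-th coordinate is `a_{m mod n₀}`. -/
def periodicSeq {Y : Type*} {n₀ : ℕ} [NeZero n₀] (a : Fin n₀ → Y) : ℤ → Y :=
  fun m => a (Fin.ofNat n₀ (m % (n₀ : ℤ)).toNat)

/-- The metric `d(x, y) = ∑_{m ∈ ℤ} 2^{-|m|} d₀(x_m, y_m)` on two-sided sequences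
(the series converges as soon as `Y` has finite diameter). -/
def biDist {Y : Type*} [MetricSpace Y] (x y : ℤ → Y) : ℝ :=
  ∑' m : ℤ, (1 / 2 : ℝ) ^ m.natAbs * dist (x m) (y m)

/-- `B` is a neighbourhood of `x` for the metric `biDist`. -/
def IsBiNhd {Y : Type*} [MetricSpace Y] (B : Set (ℤ → Y)) (x : ℤ → Y) : Prop :=
  ∃ r : ℝ, 0 < r ∧ {y | biDist x y < r} ⊆ B

/-- Stationarity of a one-sided process: `(ζ_{n+1})_n` and `(ζ_n)_n` have the same law. -/
def IsStationaryProcess {Ω₀ Y : Type*} [MeasurableSpace Ω₀] [MeasurableSpace Y]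
    (P₀ : Measure Ω₀) (ζ : ℕ → Ω₀ → Y) : Prop :=
  P₀.map (fun x (n : ℕ) => ζ (n + 1) x) = P₀.map (fun x (n : ℕ) => ζ n x)

/-- Stretched exponential `α`-mixing:
`|P₀(A ∩ B) - P₀(A) P₀(B)| ≤ C exp(-b n^γ)` for all `A ∈ σ{ζ_1, …, ζ_k}` and
`B ∈ σ{ζ_i : i ≥ k + n}`. -/
def IsStretchedExpMixing {Ω₀ Y : Type*} [MeasurableSpace Ω₀] [MeasurableSpace Y]
    (P₀ : Measure Ω₀) (ζ : ℕ → Ω₀ → Y) : Prop :=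
  ∃ C b γ : ℝ, 0 < C ∧ 0 < b ∧ 0 < γ ∧
    ∀ n k : ℕ, 1 ≤ n → 1 ≤ k → ∀ A B : Set Ω₀,
      MeasurableSet[⨆ i ∈ Set.Icc 1 k, MeasurableSpace.comap (ζ i) inferInstance] A →
      MeasurableSet[⨆ i ∈ Set.Ici (k + n), MeasurableSpace.comap (ζ i) inferInstance] B →
      |P₀.real (A ∩ B) - P₀.real A * P₀.real B| ≤ C * Real.exp (-b * (n : ℝ) ^ γ)

/-- `P`, a measure on `Y^ℤ` with the product `σ`-algebra, is the law of the two-sided shift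
associated with the process `ζ`:
`P{y : y_i ∈ A_i, |i| ≤ N} = P₀(ζ_i ∈ A_{i-N}, 0 ≤ i ≤ 2N)`. -/
def IsBiShiftLaw {Ω₀ Y : Type*} [MeasurableSpace Ω₀] [MeasurableSpace Y]
    (P₀ : Measure Ω₀) (ζ : ℕ → Ω₀ → Y) (P : Measure (ℤ → Y)) : Prop :=
  ∀ (N : ℕ) (A : ℤ → Set Y), (∀ i, MeasurableSet (A i)) →
    P {y | ∀ i : ℤ, |i| ≤ (N : ℤ) → y i ∈ A i} =
      P₀ {x | ∀ i : ℕ, i ≤ 2 * N → ζ i x ∈ A ((i : ℤ) - (N : ℤ))}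

/-- The set `⋂_{i=0}^{s n₀ - 1} θ^{-i} B_{i mod n₀}` of sequences whose orbit follows
`B_0, …, B_{n₀-1}` cyclically for `s` rounds. -/
def followSet {Y : Type*} {n₀ : ℕ} [NeZero n₀] (B : Fin n₀ → Set (ℤ → Y)) (s : ℕ) :
    Set (ℤ → Y) :=
  ⋂ i ∈ Finset.range (s * n₀), (biShift^[i]) ⁻¹' B (Fin.ofNat n₀ i)

/-- The number of visits `∑_{j=0}^{n-1} 𝟙_E(θ^j ω)`. -/
def visitCount {Y : Type*} (E : Set (ℤ → Y)) (n : ℕ) (ω : ℤ → Y) : ℝ :=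
  ∑ j ∈ Finset.range n, E.indicator (fun _ => (1 : ℝ)) (biShift^[j] ω)

end

open scoped Topology

/-! The set of followers is a neighbourhood of the periodic point, so it contains an open cylinder,
whose probability `p` is positive by the assumption on repeated words. It therefore suffices to
bound from below the visits to a cylinder, that is, occurrences of a window event of the one-sided
process. With `L` the integer square root of `n`, the first `L * L` times split into `L`
progressions of step `L`. Along each, successive windows are almost `L` apart, so mixing makes each
occurrence have conditional probability at least `p`, up to a stretched exponential error. The
recursion in `measureReal_hitCount_le` then makes fewer than a fixed multiple of `L` visits
exponentially unlikely. If the total is small, so is some progression (`exists_hitCount_le`). The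
union bound costs a factor `L`, and the resulting rate beats every power of `n`
(`tendsto_rate_atTop`). -/

/-! ### Neighbourhoods of the periodic point. -/

theorem continuous_biShift {Y : Type*} [TopologicalSpace Y] :
    Continuous (biShift : (ℤ → Y) → (ℤ → Y)) :=
  continuous_pi fun m => continuous_apply (m + 1)

theorem biShift_iterate_apply {Y : Type*} (j : ℕ) (ω : ℤ → Y) (m : ℤ) :
    (biShift^[j] ω) m = ω (m + j) := by
  induction j generalizing m with
  | zero => simp
  | succ j ih =>
    rw [Function.iterate_succ_apply']
    simp only [biShift, ih]
    congr 1
    push_cast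
    ring

theorem periodicSeq_eq_of_emod_eq {Y : Type*} {n₀ : ℕ} [NeZero n₀] (a : Fin n₀ → Y) {m k : ℤ}
    (h : m % (n₀ : ℤ) = k % (n₀ : ℤ)) : periodicSeq a m = periodicSeq a k := by
  simp only [periodicSeq, h]

theorem biShift_iterate_periodicSeq {Y : Type*} {n₀ : ℕ} [NeZero n₀] (a : Fin n₀ → Y) (i : ℕ) :
    biShift^[i] (periodicSeq a) = biShift^[((Fin.ofNat n₀ i : Fin n₀) : ℕ)] (periodicSeq a) := by
  funext m
  rw [biShift_iterate_apply, biShift_iterate_apply]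
  apply periodicSeq_eq_of_emod_eq
  simp [Fin.ofNat]

theorem summable_half_pow_natAbs : Summable fun m : ℤ => (1 / 2 : ℝ) ^ m.natAbs := by
  have h : Summable fun n : ℕ => (1 / 2 : ℝ) ^ n := summable_geometric_two
  apply Summable.of_nat_of_neg <;> simpa using h

/-- The series defining `biDist` converges uniformly because the diameter is at most 1, so its balls
are open in the product topology. -/
theorem IsBiNhd.mem_nhds {Y : Type*} [MetricSpace Y] (hdiam : ∀ y y' : Y, dist y y' ≤ 1)
    {B : Set (ℤ → Y)} {x : ℤ → Y} (h : IsBiNhd B x) : B ∈ 𝓝 x := by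
  obtain ⟨r, hr, hB⟩ := h
  refine Filter.mem_of_superset (IsOpen.mem_nhds ?_ ?_) hB
  · refine isOpen_lt ?_ continuous_const
    refine continuous_tsum (u := fun m : ℤ => (1 / 2 : ℝ) ^ m.natAbs) (fun m => by fun_prop)
      summable_half_pow_natAbs fun m y => ?_
    rw [Real.norm_of_nonneg (by positivity)]
    exact mul_le_of_le_one_right (by positivity) (hdiam _ _)
  · simpa [biDist] using hr

theorem followSet_mem_nhds {Y : Type*} [MetricSpace Y] (hdiam : ∀ y y' : Y, dist y y' ≤ 1)
    {n₀ : ℕ} [NeZero n₀] (a : Fin n₀ → Y) (s : ℕ) (B : Fin n₀ → Set (ℤ → Y))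
    (hB : ∀ j : Fin n₀, IsBiNhd (B j) (biShift^[(j : ℕ)] (periodicSeq a))) :
    followSet B s ∈ 𝓝 (periodicSeq a) := by
  refine (Filter.biInter_finset_mem _).2 fun i _ => ?_
  refine (continuous_biShift.iterate i).continuousAt ?_
  rw [biShift_iterate_periodicSeq]
  exact (hB _).mem_nhds hdiam

/-- A neighbourhood of a periodic sequence for the product topology contains a cylinder whose base
consists of open sets, over a window centred at a multiple of the period. -/
theorem exists_cylinder_subset {Y : Type*} [MetricSpace Y] {n₀ : ℕ} [NeZero n₀] (a : Fin n₀ → Y)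
    {E : Set (ℤ → Y)} (hE : E ∈ 𝓝 (periodicSeq a)) :
    ∃ (K : ℕ) (U : ℕ → Set Y), (∀ k, IsOpen (U k)) ∧ (∀ k : ℕ, periodicSeq a k ∈ U k) ∧
      {ω : ℤ → Y | ∀ i : ℕ, i ≤ 2 * (K * n₀) → ω ((i : ℤ) - (K * n₀ : ℕ)) ∈ U i} ⊆ E := by
  rw [nhds_pi, Filter.mem_pi'] at hE
  obtain ⟨I, t, ht, hI⟩ := hE
  have hn : 1 ≤ n₀ := NeZero.one_le
  set K : ℕ := I.sup Int.natAbs with hK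
  -- Half-width `K * n₀` covers the finitely many constrained coordinates; being a multiple of the
  -- period, it makes the word seen from the left end of the window start at `a 0`.
  refine ⟨K, fun k => interior (t ((k : ℤ) - (K * n₀ : ℕ))), fun k => isOpen_interior,
    fun k => ?_, fun ω hω => hI fun m hm => ?_⟩
  · rw [show periodicSeq a (k : ℤ) = periodicSeq a ((k : ℤ) - (K * n₀ : ℕ)) from
      periodicSeq_eq_of_emod_eq a (by push_cast; simp)]
    exact mem_interior_iff_mem_nhds.2 (ht _)
  · have h1 : m.natAbs ≤ K := Finset.le_sup (f := Int.natAbs) hm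
    have h2 : m.natAbs ≤ K * n₀ := h1.trans (Nat.le_mul_of_pos_right _ hn)
    have h3 := hω (m + (K * n₀ : ℕ)).toNat (by omega)
    simp only [Int.toNat_of_nonneg (show 0 ≤ m + (K * n₀ : ℕ) by omega),
      add_sub_cancel_right] at h3
    exact interior_subset h3

/-! ### Finite windows of the two-sided law. -/

/-- The window of length `2 * N + 1` of the two-sided process has the law of the first `2 * N + 1`
terms of the one-sided process. -/
theorem IsBiShiftLaw.map_eq {Ω₀ Y : Type*} [MeasurableSpace Ω₀] [MeasurableSpace Y]
    {P₀ : Measure Ω₀} [IsProbabilityMeasure P₀] {ζ : ℕ → Ω₀ → Y} (hζ : ∀ n, Measurable (ζ n))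
    {P : Measure (ℤ → Y)} [IsProbabilityMeasure P] (hP : IsBiShiftLaw P₀ ζ P) (N : ℕ) :
    P.map (fun ω (i : Fin (2 * N + 1)) => ω ((i : ℕ) - (N : ℤ))) =
      P₀.map (fun x (i : Fin (2 * N + 1)) => ζ i x) := by
  have m1 : Measurable fun (ω : ℤ → Y) (i : Fin (2 * N + 1)) => ω ((i : ℕ) - (N : ℤ)) :=
    measurable_pi_lambda _ fun i => measurable_pi_apply _
  have m2 : Measurable fun x (i : Fin (2 * N + 1)) => ζ i x :=
    measurable_pi_lambda _ fun i => hζ _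
  have := Measure.isProbabilityMeasure_map (μ := P) m1.aemeasurable
  have := Measure.isProbabilityMeasure_map (μ := P₀) m2.aemeasurable
  -- The hypothesis concerns rectangles only; these form a generating π-system.
  refine ext_of_generate_finite _ generateFrom_pi.symm isPiSystem_pi ?_ (by simp)
  rintro _ ⟨A, hA, rfl⟩
  have hA : ∀ i, MeasurableSet (A i) := fun i => hA i trivial
  have hAm : MeasurableSet (Set.univ.pi A) := MeasurableSet.univ_pi hA
  rw [Measure.map_apply m1 hAm, Measure.map_apply m2 hAm]
  convert hP N (fun i => A (Fin.ofNat (2 * N + 1) (i + N).toNat)) (fun i => hA _) using 2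
  · ext ω
    simp only [Set.mem_preimage, Set.mem_univ_pi, Set.mem_ofPred_eq]
    constructor
    · intro h i hi
      rw [abs_le] at hi
      have := h (Fin.ofNat (2 * N + 1) (i + N).toNat)
      rwa [Fin.val_ofNat, Nat.mod_eq_of_lt (by omega), Int.toNat_of_nonneg (by omega),
        add_sub_cancel_right] at this
    · intro h i
      have := h ((i : ℕ) - (N : ℤ)) (abs_le.2 (by omega))
      simpa using this
  · ext x
    simp only [Set.mem_preimage, Set.mem_univ_pi, Set.mem_ofPred_eq]
    constructor
    · intro h i hi
      have := h (Fin.ofNat (2 * N + 1) i)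
      rw [Fin.val_ofNat, Nat.mod_eq_of_lt (by omega)] at this
      simpa using this
    · intro h i
      have := h i (by omega)
      simpa using this

/-! ### Lower deviations for counts of events. -/

/-- The number of the first `k` sets that contain a point. -/
noncomputable def hitCount {Ω : Type*} (X : ℕ → Set Ω) (k : ℕ) (ω : Ω) : ℕ :=
  ∑ i ∈ Finset.range k, (X i).indicator (fun _ => 1) ω

theorem measurable_hitCount {Ω : Type*} [MeasurableSpace Ω] {X : ℕ → Set Ω} {k : ℕ}
    (hX : ∀ i < k, MeasurableSet (X i)) : Measurable (hitCount X k) :=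
  Finset.measurable_fun_sum _ fun i hi =>
    measurable_const.indicator (hX i (Finset.mem_range.1 hi))

/-- A lower deviation bound for the number of events that occur, when each event has conditional
probability at least `p` given the preceding ones, up to an error `ε`. -/
theorem measureReal_hitCount_le {Ω : Type*} [MeasurableSpace Ω] (μ : Measure Ω)
    [IsProbabilityMeasure μ] {X : ℕ → Set Ω} {n : ℕ} (hX : ∀ i < n, MeasurableSet (X i))
    {p ε : ℝ} (hp1 : p ≤ 1) (hp0 : 0 ≤ p) (hε : 0 ≤ ε)
    (h : ∀ k < n, ∀ m, p * μ.real {ω | hitCount X k ω = m} - ε ≤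
      μ.real ({ω | hitCount X k ω = m} ∩ X k)) (k : ℕ) (hk : k ≤ n) (m : ℕ) :
    μ.real {ω | hitCount X k ω ≤ m} ≤ 2 ^ m * (1 - p / 2) ^ k + k * ε := by
  -- With `S k` the count, `P(S (k+1) ≤ m) ≤ (1 - p) P(S k ≤ m) + p P(S k ≤ m - 1) + ε`. The weight
  -- `2 ^ m` closes the recursion, since `(1 - p) 2 ^ m + p 2 ^ (m - 1) = 2 ^ m (1 - p / 2)`.
  induction k generalizing m with
  | zero =>
    simp only [pow_zero, mul_one, Nat.cast_zero, zero_mul, add_zero]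
    exact measureReal_le_one.trans (one_le_pow₀ (by norm_num))
  | succ k ih =>
    have ih := fun m => ih (by omega) m
    have hmeas : Measurable (hitCount X k) := measurable_hitCount fun i hi => hX i (by omega)
    have hXk := hX k (by omega)
    have hsucc : ∀ ω, hitCount X (k + 1) ω = hitCount X k ω + (X k).indicator (fun _ => 1) ω :=
      fun ω => Finset.sum_range_succ _ _
    have hsplit : {ω | hitCount X (k + 1) ω ≤ m} =
        {ω | hitCount X k ω ≤ m} \ ({ω | hitCount X k ω = m} ∩ X k) := by
      ext ω
      by_cases hω : ω ∈ X k
      · simp [hsucc, hω]; omega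
      · simp [hsucc, hω]
    have heq : MeasurableSet {ω | hitCount X k ω = m} := hmeas (measurableSet_singleton m)
    have hdiff : μ.real {ω | hitCount X (k + 1) ω ≤ m} =
        μ.real {ω | hitCount X k ω ≤ m} - μ.real ({ω | hitCount X k ω = m} ∩ X k) := by
      rw [hsplit]
      exact measureReal_sdiff (fun ω hω => le_of_eq hω.1) (heq.inter hXk)
    have hk' := h k (by omega) m
    have hpos : 0 ≤ (1 - p / 2) ^ k := pow_nonneg (by linarith) _
    have ihm := ih m
    rcases m with _ | m
    · have h0 : {ω | hitCount X k ω ≤ 0} = {ω | hitCount X k ω = 0} := by ext; simp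
      rw [hdiff]
      rw [h0] at ihm ⊢
      have := mul_le_mul_of_nonneg_left ihm (sub_nonneg.2 hp1)
      have h2 : 0 ≤ p * (1 - p / 2) ^ k := mul_nonneg hp0 hpos
      have h4 : 0 ≤ p * (k * ε) := by positivity
      rw [pow_succ]
      push_cast
      linarith
    · have hle : μ.real {ω | hitCount X k ω ≤ m + 1} =
          μ.real {ω | hitCount X k ω ≤ m} + μ.real {ω | hitCount X k ω = m + 1} := by
        rw [← measureReal_union _ heq]
        · congr 1; ext ω; simp; omega
        · rw [Set.disjoint_left]; intro ω h1 h2; simp at h1 h2; omega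
      have ihm' := ih m
      rw [hdiff]
      have e : μ.real {ω | hitCount X k ω = m + 1} = μ.real {ω | hitCount X k ω ≤ m + 1} -
        μ.real {ω | hitCount X k ω ≤ m} := by linarith
      rw [e] at hk'
      have q1 := mul_le_mul_of_nonneg_left ihm (sub_nonneg.2 hp1)
      have q2 := mul_le_mul_of_nonneg_left ihm' hp0
      rw [pow_succ (1 - p / 2), pow_succ (2 : ℝ)]
      rw [pow_succ (2 : ℝ)] at q1
      push_cast
      linarith

theorem Finset.sum_range_mul_eq_sum_sum_add_mul {M : Type*} [AddCommMonoid M] (f : ℕ → M)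
    (K L : ℕ) : ∑ j ∈ range (K * L), f j = ∑ r ∈ range L, ∑ k ∈ range K, f (r + k * L) := by
  rw [sum_comm]
  induction K with
  | zero => simp
  | succ K ih => rw [sum_range_succ, ← ih, Nat.succ_mul, sum_range_add]; simp [add_comm]

theorem hitCount_congr {Ω Ω' : Type*} {X : ℕ → Set Ω} {X' : ℕ → Set Ω'} {k : ℕ} {ω : Ω} {ω' : Ω'}
    (h : ∀ j < k, ω ∈ X j ↔ ω' ∈ X' j) : hitCount X k ω = hitCount X' k ω' := by
  classical
  refine Finset.sum_congr rfl fun j hj => ?_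
  simp only [Set.indicator_apply, h j (Finset.mem_range.1 hj)]

/-- Otherwise every residue class modulo `L` would contribute more than `x`; the floor is harmless
because counts are integers. -/
theorem exists_hitCount_le {Ω : Type*} (X : ℕ → Set Ω) {L : ℕ} (hL : 1 ≤ L) {x : ℝ} {ω : Ω}
    (h : (hitCount X (L * L) ω : ℝ) ≤ L * x) :
    ∃ r < L, hitCount (fun k => X (r + k * L)) L ω ≤ ⌊x⌋₊ := by
  by_contra! hcon
  refine h.not_gt ?_
  have e : hitCount X (L * L) ω =
      ∑ r ∈ Finset.range L, hitCount (fun k => X (r + k * L)) L ω :=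
    Finset.sum_range_mul_eq_sum_sum_add_mul _ _ _
  rw [e, Nat.cast_sum]
  calc (L : ℝ) * x = ∑ r ∈ Finset.range L, x := by simp
    _ < _ := Finset.sum_lt_sum_of_nonempty (Finset.nonempty_range_iff.2 (by omega))
      fun r hr => Nat.lt_of_floor_lt (hcon r (Finset.mem_range.1 hr))

/-! ### Window events under stationarity and mixing. -/

/-- The event that the process `ζ`, from time `j` on, visits `U 0, …, U w` successively. -/
def windowEvent {Ω Y : Type*} (ζ : ℕ → Ω → Y) (U : ℕ → Set Y) (w j : ℕ) : Set Ω :=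
  {x | ∀ i ≤ w, ζ (j + i) x ∈ U i}

section Window

variable {Ω Y : Type*} [MeasurableSpace Y] {ζ : ℕ → Ω → Y} {U : ℕ → Set Y} {w : ℕ}

theorem measurableSet_windowEvent (hU : ∀ i, MeasurableSet (U i)) {j : ℕ} {S : Set ℕ}
    (hS : ∀ i ≤ w, j + i ∈ S) :
    MeasurableSet[⨆ i ∈ S, MeasurableSpace.comap (ζ i) inferInstance] (windowEvent ζ U w j) := by
  have e : windowEvent ζ U w j = ⋂ i ∈ Set.Iic w, ζ (j + i) ⁻¹' U i := by
    ext x; simp [windowEvent]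
  rw [e]
  refine MeasurableSet.biInter (Set.to_countable _) fun i hi => ?_
  have hle : MeasurableSpace.comap (ζ (j + i)) inferInstance ≤
      ⨆ i ∈ S, MeasurableSpace.comap (ζ i) inferInstance :=
    le_iSup₂_of_le (f := fun i (_ : i ∈ S) => MeasurableSpace.comap (ζ i) inferInstance)
      (j + i) (hS i hi) le_rfl
  exact hle _ ⟨U i, hU i, rfl⟩

theorem measurableSet_windowEvent' [MeasurableSpace Ω] (hζ : ∀ n, Measurable (ζ n))
    (hU : ∀ i, MeasurableSet (U i)) (j : ℕ) : MeasurableSet (windowEvent ζ U w j) := by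
  have hle : (⨆ i ∈ Set.univ, MeasurableSpace.comap (ζ i) inferInstance : MeasurableSpace Ω) ≤
      ‹MeasurableSpace Ω› := iSup₂_le fun i _ => (hζ i).comap_le
  exact hle _ (measurableSet_windowEvent hU fun i _ => Set.mem_univ _)

theorem IsStationaryProcess.measure_windowEvent [MeasurableSpace Ω] {P₀ : Measure Ω}
    (hstat : IsStationaryProcess P₀ ζ) (hζ : ∀ n, Measurable (ζ n))
    (hU : ∀ i, MeasurableSet (U i)) (j : ℕ) :
    P₀ (windowEvent ζ U w j) = P₀ (windowEvent ζ U w 0) := by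
  induction j with
  | zero => rfl
  | succ j ih =>
    rw [← ih]
    have hV : MeasurableSet (windowEvent (fun n (z : ℕ → Y) => z n) U w j) :=
      measurableSet_windowEvent' (fun n => measurable_pi_apply n) hU j
    have h := congrArg (fun ν => ν (windowEvent (fun n (z : ℕ → Y) => z n) U w j)) hstat
    beta_reduce at h
    rw [Measure.map_apply (measurable_pi_lambda _ fun n => hζ _) hV,
      Measure.map_apply (measurable_pi_lambda _ fun n => hζ _) hV] at h
    refine Eq.trans ?_ h
    refine congrArg P₀ (Set.ext fun x => forall₂_congr fun i _ => ?_)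
    rw [add_right_comm]

/-- A lower deviation bound for visits at the times of an arithmetic progression. -/
theorem measureReal_hitCount_windowEvent_le [MeasurableSpace Ω] {P₀ : Measure Ω}
    [IsProbabilityMeasure P₀] (hζ : ∀ n, Measurable (ζ n)) (hstat : IsStationaryProcess P₀ ζ)
    (hU : ∀ i, MeasurableSet (U i)) {L T : ℕ} (hL : w < L) (hT : L < T) {ε : ℝ}
    (hmix : ∀ k : ℕ, 1 ≤ k → ∀ A B : Set Ω,
      MeasurableSet[⨆ i ∈ Set.Icc 1 k, MeasurableSpace.comap (ζ i) inferInstance] A →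
      MeasurableSet[⨆ i ∈ Set.Ici (k + (L - w)), MeasurableSpace.comap (ζ i) inferInstance] B →
      |P₀.real (A ∩ B) - P₀.real A * P₀.real B| ≤ ε) (r n m : ℕ) :
    P₀.real {x | hitCount (fun k => windowEvent ζ U w (T + (r + k * L))) n x ≤ m} ≤
      2 ^ m * (1 - P₀.real (windowEvent ζ U w 0) / 2) ^ n + n * ε := by
  have hε : 0 ≤ ε := (abs_nonneg _).trans (hmix 1 le_rfl ∅ ∅ (@MeasurableSet.empty _ (_))
    (@MeasurableSet.empty _ (_)))
  refine measureReal_hitCount_le P₀ (fun i _ => measurableSet_windowEvent' hζ hU _)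
    measureReal_le_one measureReal_nonneg hε (fun k _ m => ?_) n le_rfl m
  -- The preceding windows end by this time, leaving a gap of `L - w`. The offset `T > L` keeps it
  -- at least 1, as the mixing condition requires.
  have hA := hmix (T + (r + k * L) - (L - w)) (by omega)
    {x | hitCount (fun k => windowEvent ζ U w (T + (r + k * L))) k x = m}
    (windowEvent ζ U w (T + (r + k * L))) ?_ ?_
  · have e : P₀.real (windowEvent ζ U w (T + (r + k * L))) = P₀.real (windowEvent ζ U w 0) := by
      simp only [measureReal_def, hstat.measure_windowEvent hζ hU]
    rw [e] at hA
    linarith [(abs_le.1 hA).1]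
  · refine (@measurable_hitCount _ (_) _ k fun i hi => ?_) (measurableSet_singleton m)
    refine measurableSet_windowEvent hU fun l hl => ⟨?_, ?_⟩
    · omega
    · have : (i + 1) * L ≤ k * L := Nat.mul_le_mul_right _ hi
      rw [Nat.succ_mul] at this
      omega
  · refine measurableSet_windowEvent hU fun l hl => ?_
    simp only [Set.mem_Ici]
    omega

end Window

/-- The number of visits of the two-sided shift to a cylinder has the law of the number of
occurrences of a window event. -/
theorem IsBiShiftLaw.measure_hitCount {Ω₀ Y : Type*} [MeasurableSpace Ω₀] [MeasurableSpace Y]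
    {P₀ : Measure Ω₀} [IsProbabilityMeasure P₀] {ζ : ℕ → Ω₀ → Y} (hζ : ∀ n, Measurable (ζ n))
    {P : Measure (ℤ → Y)} [IsProbabilityMeasure P] (hP : IsBiShiftLaw P₀ ζ P)
    {U : ℕ → Set Y} (hU : ∀ i, MeasurableSet (U i)) (M : ℕ) {n T : ℕ} (hn : n ≤ T) (S : Set ℕ) :
    P {ω | hitCount (fun j => biShift^[j] ⁻¹'
        {ω : ℤ → Y | ∀ i : ℕ, i ≤ 2 * M → ω ((i : ℤ) - (M : ℤ)) ∈ U i}) n ω ∈ S} =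
      P₀ {x | hitCount (fun j => windowEvent ζ U (2 * M) (T + j)) n x ∈ S} := by
  have h := hP.map_eq hζ (M + T)
  -- Coordinates of the common finite window. Reduction modulo its length never acts: the indices `T
  -- + j + i` used stay at most `2 * (M + T)`, because `j < n ≤ T`.
  set z : ℕ → (Fin (2 * (M + T) + 1) → Y) → Y := fun n y => y (Fin.ofNat _ n) with hz
  have hzm : ∀ n, Measurable (z n) := fun n => measurable_pi_apply _
  have hm : MeasurableSet {y | hitCount (fun j => windowEvent z U (2 * M) (T + j)) n y ∈ S} :=
    (measurable_hitCount fun j _ => measurableSet_windowEvent' hzm hU _) (.of_discrete)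
  have h := congrArg (fun ν => ν {y | hitCount (fun j => windowEvent z U (2 * M) (T + j)) n y ∈ S})
    h
  beta_reduce at h
  rw [Measure.map_apply (measurable_pi_lambda _ fun i => measurable_pi_apply _) hm,
    Measure.map_apply (measurable_pi_lambda _ fun i => hζ _) hm] at h
  convert h using 2
  · ext ω
    refine iff_of_eq (congrArg (· ∈ S) (hitCount_congr fun j hj => ?_))
    refine forall₂_congr fun i hi => ?_
    have e : (((T + j + i : ℕ) : ℤ) - ((M + T : ℕ) : ℤ)) = (i : ℤ) - M + j := by
      push_cast; ring
    simp only [hz, Fin.val_ofNat]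
    rw [Nat.mod_eq_of_lt (by omega), e, biShift_iterate_apply]
  · ext x
    refine iff_of_eq (congrArg (· ∈ S) (hitCount_congr fun j hj => ?_))
    refine forall₂_congr fun i hi => ?_
    simp only [hz, Fin.val_ofNat]
    rw [Nat.mod_eq_of_lt (by omega)]

/-! ### Rates, and the bound over `L * L` times. -/

theorem tendsto_rpow_mul_exp_neg_mul_rpow_atTop {s b γ : ℝ} (hb : 0 < b) (hγ : 0 < γ) :
    Filter.Tendsto (fun x : ℝ => x ^ s * Real.exp (-b * x ^ γ)) Filter.atTop (𝓝 0) := by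
  refine ((tendsto_rpow_mul_exp_neg_mul_atTop_nhds_zero (s / γ) b hb).comp
    (tendsto_rpow_atTop hγ)).congr' ?_
  filter_upwards [Filter.eventually_gt_atTop 0] with x hx
  simp only [Function.comp]
  rw [← Real.rpow_mul hx.le, mul_div_cancel₀ _ hγ.ne']

/-- The factor `(4 * L ^ 2) ^ β` stands for `n ^ β`, as `n ≤ 4 * L ^ 2` for `L` the integer square
root of `n`. Once `L > 2 * w` the gap `L - w` is at least `L / 2`, which only changes the constant
`b`. -/
theorem tendsto_rate_atTop {β κ C b γ : ℝ} (hκ : 0 < κ) (hC : 0 < C) (hb : 0 < b) (hγ : 0 < γ)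
    (w : ℕ) :
    Filter.Tendsto (fun L : ℕ => (4 * (L : ℝ) ^ 2) ^ β * (L * (Real.exp (-κ * L) +
      L * (C * Real.exp (-b * ((L - w : ℕ) : ℝ) ^ γ))))) Filter.atTop (𝓝 0) := by
  have h1 := (tendsto_rpow_mul_exp_neg_mul_rpow_atTop (s := 2 * β + 1) hκ one_pos).const_mul
    ((4 : ℝ) ^ β)
  have h2 := (tendsto_rpow_mul_exp_neg_mul_rpow_atTop (s := 2 * β + 2)
    (b := b * (1 / 2) ^ γ) (by positivity) hγ).const_mul ((4 : ℝ) ^ β * C)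
  have h := (h1.add h2).comp tendsto_natCast_atTop_atTop (α := ℕ)
  simp only [mul_zero, add_zero] at h
  refine squeeze_zero' (Filter.Eventually.of_forall fun L => by positivity) ?_ h
  filter_upwards [Filter.eventually_ge_atTop (2 * w + 1)] with L hL
  have hL0 : (0 : ℝ) < L := by exact_mod_cast (by omega : 0 < L)
  have e1 : (4 * (L : ℝ) ^ 2) ^ β = 4 ^ β * (L : ℝ) ^ (2 * β) := by
    rw [Real.mul_rpow (by norm_num) (by positivity), Real.rpow_mul hL0.le, Real.rpow_two]
  have e2 : (L : ℝ) ^ (2 * β + 1) = (L : ℝ) ^ (2 * β) * L := Real.rpow_add_one hL0.ne' _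
  have e3 : (L : ℝ) ^ (2 * β + 2) = (L : ℝ) ^ (2 * β) * (L * L) := by
    rw [Real.rpow_add hL0, Real.rpow_two, sq]
  have e4 : Real.exp (-b * ((L - w : ℕ) : ℝ) ^ γ) ≤
      Real.exp (-(b * (1 / 2) ^ γ) * (L : ℝ) ^ γ) := by
    refine Real.exp_le_exp.2 ?_
    have hle : (1 / 2 : ℝ) * L ≤ ((L - w : ℕ) : ℝ) := by
      rw [Nat.cast_sub (by omega)]
      have : ((2 * w + 1 : ℕ) : ℝ) ≤ L := by exact_mod_cast hL
      push_cast at this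
      linarith
    have := mul_le_mul_of_nonneg_left (Real.rpow_le_rpow (by positivity) hle hγ.le) hb.le
    rw [Real.mul_rpow (by norm_num) hL0.le] at this
    linarith
  simp only [Function.comp, Real.rpow_one]
  rw [e1, e2, e3]
  calc 4 ^ β * (L : ℝ) ^ (2 * β) * (L * (Real.exp (-κ * L) +
      L * (C * Real.exp (-b * ((L - w : ℕ) : ℝ) ^ γ))))
      ≤ 4 ^ β * (L : ℝ) ^ (2 * β) * (L * (Real.exp (-κ * L) +
      L * (C * Real.exp (-(b * (1 / 2) ^ γ) * (L : ℝ) ^ γ)))) := by gcongr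
    _ = _ := by ring

/-- A lower deviation bound for the number of occurrences of a window event at `L * L` consecutive
times, by splitting the times into residue classes modulo `L`. -/
theorem measureReal_hitCount_windowEvent_sq_le {Ω Y : Type*} [MeasurableSpace Ω]
    [MeasurableSpace Y] {P₀ : Measure Ω} [IsProbabilityMeasure P₀] {ζ : ℕ → Ω → Y} {U : ℕ → Set Y}
    {w : ℕ} (hζ : ∀ n, Measurable (ζ n)) (hstat : IsStationaryProcess P₀ ζ)
    (hU : ∀ i, MeasurableSet (U i)) {L : ℕ} (hL : w < L) {ε : ℝ}
    (hmix : ∀ k : ℕ, 1 ≤ k → ∀ A B : Set Ω,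
      MeasurableSet[⨆ i ∈ Set.Icc 1 k, MeasurableSpace.comap (ζ i) inferInstance] A →
      MeasurableSet[⨆ i ∈ Set.Ici (k + (L - w)), MeasurableSpace.comap (ζ i) inferInstance] B →
      |P₀.real (A ∩ B) - P₀.real A * P₀.real B| ≤ ε) {κ : ℝ} (hκ : 0 ≤ κ)
    (hp : 1 - P₀.real (windowEvent ζ U w 0) / 2 ≤ Real.exp (-(2 * κ))) :
    P₀.real {x | (hitCount (fun j => windowEvent ζ U w (L * L + 1 + j)) (L * L) x : ℝ) ≤
        L * (κ / Real.log 2 * L)} ≤ L * (Real.exp (-κ * L) + L * ε) := by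
  have hlog : 0 < Real.log 2 := Real.log_pos (by norm_num)
  have h1 : ∀ r, P₀.real {x | hitCount (fun k => windowEvent ζ U w (L * L + 1 + (r + k * L))) L x ≤
      ⌊κ / Real.log 2 * L⌋₊} ≤ Real.exp (-κ * L) + L * ε := fun r => by
    refine (measureReal_hitCount_windowEvent_le hζ hstat hU hL (T := L * L + 1) ?_ hmix
      r L _).trans ?_
    · nlinarith
    · refine add_le_add_left ?_ _
      -- The threshold is chosen so that the weight `2 ^ m` uses up only half of the decay `exp (-(2
      -- * κ) * L)`.
      have a1 : (2 : ℝ) ^ ⌊κ / Real.log 2 * L⌋₊ ≤ Real.exp (κ * L) := by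
        rw [← Real.rpow_natCast, Real.rpow_def_of_pos (by norm_num)]
        refine Real.exp_le_exp.2 ?_
        have := mul_le_mul_of_nonneg_left
          (Nat.floor_le (show 0 ≤ κ / Real.log 2 * L by positivity)) hlog.le
        refine this.trans_eq ?_
        field_simp
      have a0 : 0 ≤ 1 - P₀.real (windowEvent ζ U w 0) / 2 := by
        linarith [measureReal_le_one (μ := P₀) (s := windowEvent ζ U w 0)]
      have a2 : (1 - P₀.real (windowEvent ζ U w 0) / 2) ^ L ≤ Real.exp (-(2 * κ) * L) := by
        rw [mul_comm, Real.exp_nat_mul]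
        exact pow_le_pow_left₀ a0 hp _
      calc _ ≤ Real.exp (κ * L) * Real.exp (-(2 * κ) * L) := by gcongr
        _ = _ := by rw [← Real.exp_add]; ring_nf
  calc _ ≤ P₀.real (⋃ r ∈ Finset.range L, {x | hitCount
          (fun k => windowEvent ζ U w (L * L + 1 + (r + k * L))) L x ≤ ⌊κ / Real.log 2 * L⌋₊}) := by
        refine measureReal_mono (fun x hx => ?_) (measure_ne_top _ _)
        obtain ⟨r, hr, h⟩ := exists_hitCount_le
          (fun j => windowEvent ζ U w (L * L + 1 + j)) (by omega) hx
        exact Set.mem_biUnion (Finset.mem_coe.2 (Finset.mem_range.2 hr)) h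
    _ ≤ ∑ r ∈ Finset.range L, (Real.exp (-κ * L) + L * ε) :=
        (measureReal_biUnion_finset_le _ _).trans (Finset.sum_le_sum fun r _ => h1 r)
    _ = _ := by simp only [Finset.sum_const, Finset.card_range, nsmul_eq_mul]

/-! ### From cylinder visits to the theorem. -/

theorem hitCount_le_visitCount {Y : Type*} {G E : Set (ℤ → Y)} (h : G ⊆ E) {m n : ℕ} (hmn : m ≤ n)
    (ω : ℤ → Y) : (hitCount (fun j => biShift^[j] ⁻¹' G) m ω : ℝ) ≤ visitCount E n ω := by
  classical
  rw [hitCount, visitCount, Nat.cast_sum]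
  refine (Finset.sum_le_sum fun j _ => ?_).trans (Finset.sum_le_sum_of_subset_of_nonneg
    (Finset.range_subset_range.2 hmn)
    fun j _ _ => Set.indicator_nonneg (fun _ _ => zero_le_one) _)
  by_cases hG : biShift^[j] ω ∈ G
  · simp [hG, h hG]
  · simp only [Set.indicator_apply, Set.mem_preimage, hG, if_false, Nat.cast_zero]
    split_ifs <;> norm_num

theorem mainTheorem11 {Ω₀ Y : Type*} [MeasurableSpace Ω₀]
    [MetricSpace Y] [MeasurableSpace Y] [OpensMeasurableSpace Y]
    (hdiam : ∀ y y' : Y, dist y y' ≤ 1)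
    (P₀ : Measure Ω₀) [IsProbabilityMeasure P₀]
    (ζ : ℕ → Ω₀ → Y) (hζ : ∀ n, Measurable (ζ n))
    (hstat : IsStationaryProcess P₀ ζ)
    (hmix : IsStretchedExpMixing P₀ ζ)
    (P : Measure (ℤ → Y)) [IsProbabilityMeasure P]
    (hP : IsBiShiftLaw P₀ ζ P)
    (n₀ : ℕ) [NeZero n₀] (a : Fin n₀ → Y)
    (hpos : ∀ (s : ℕ) (A : Fin n₀ → ℕ → Set Y), 1 ≤ s →
      (∀ i j, IsOpen (A i j) ∧ a i ∈ A i j) →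
      0 < P₀ {x | ∀ i : Fin n₀, ∀ j : ℕ, 1 ≤ j → j ≤ s →
        ζ ((i : ℕ) + (j - 1) * n₀) x ∈ A i j}) :
    ∀ (s : ℕ) (B : Fin n₀ → Set (ℤ → Y)), 1 ≤ s →
      (∀ j : Fin n₀, IsBiNhd (B j) (biShift^[(j : ℕ)] (periodicSeq a))) →
      ∃ c : ℝ, 0 < c ∧ ∀ β : ℝ, 0 < β → ∃ d : ℝ, 0 < d ∧ ∀ n : ℕ, 1 ≤ n →
        P.real {ω | visitCount (followSet B s) n ω ≤ c * (n : ℝ)} ≤ d / (n : ℝ) ^ β := by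
  intro s B _ hB
  obtain ⟨C, b, γ, hC, hb, hγ, hmix⟩ := hmix
  obtain ⟨K, U, hUo, hUa, hUE⟩ := exists_cylinder_subset a (followSet_mem_nhds hdiam a s B hB)
  have hU : ∀ i, MeasurableSet (U i) := fun i => (hUo i).measurableSet
  have hn₀ : 0 < n₀ := NeZero.pos n₀
  set M := K * n₀ with hM
  set p := P₀.real (windowEvent ζ U (2 * M) 0) with hp
  have hp0 : 0 < p := by
    refine ENNReal.toReal_pos (ne_of_gt ?_) (measure_ne_top _ _)
    -- The indices `0, …, 2 * K * n₀` fit into `2 * K + 1` copies of the word.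
    refine (hpos (2 * K + 1) (fun i j => U (i + (j - 1) * n₀)) (by omega)
      fun i j => ⟨hUo _, ?_⟩).trans_le (measure_mono fun x hx i hi => ?_)
    · have h := hUa (i + (j - 1) * n₀)
      simp only [periodicSeq] at h
      convert h
      rw [← Int.natCast_mod, Int.toNat_natCast, Nat.add_mul_mod_self_right]
      ext
      simp [Nat.mod_eq_of_lt i.isLt]
    · have h := hx (Fin.ofNat n₀ i) (i / n₀ + 1) (Nat.le_add_left _ _) ?_
      · rw [Fin.val_ofNat, Nat.add_sub_cancel, Nat.mod_add_div'] at h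
        rwa [zero_add]
      · have : i / n₀ ≤ 2 * K := Nat.div_le_of_le_mul (by rw [hM] at hi; linarith)
        omega
  have hp1 : p ≤ 1 := measureReal_le_one
  set κ := -Real.log (1 - p / 2) / 2 with hκ
  have hκ0 : 0 < κ := by
    have := Real.log_neg (x := 1 - p / 2) (by linarith) (by linarith)
    rw [hκ]; linarith
  have hpκ : 1 - p / 2 ≤ Real.exp (-(2 * κ)) := by
    rw [hκ, show -(2 * (-Real.log (1 - p / 2) / 2)) = Real.log (1 - p / 2) by ring,
      Real.exp_log (by linarith)]
  have hlog : 0 < Real.log 2 := Real.log_pos (by norm_num)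
  have key : ∀ n : ℕ, 2 * M < n.sqrt →
      P.real {ω | visitCount (followSet B s) n ω ≤ κ / Real.log 2 / 4 * n} ≤
        n.sqrt * (Real.exp (-κ * n.sqrt) + n.sqrt *
          (C * Real.exp (-b * ((n.sqrt - 2 * M : ℕ) : ℝ) ^ γ))) := by
    intro n hn
    have hn4 : (n : ℝ) ≤ 4 * (n.sqrt * n.sqrt) := by
      have := Nat.sqrt_le_add n
      have h2 : n.sqrt ≤ n.sqrt * n.sqrt := Nat.le_mul_self _
      exact_mod_cast (by omega : n ≤ 4 * (n.sqrt * n.sqrt))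
    have h1 := measureReal_hitCount_windowEvent_sq_le hζ hstat hU hn
      (fun k hk A B => hmix (n.sqrt - 2 * M) k (by omega) hk A B) hκ0.le hpκ
    refine le_trans ?_ h1
    have h2 := hP.measure_hitCount hζ hU M (Nat.le_succ (n.sqrt * n.sqrt))
      {m : ℕ | (m : ℝ) ≤ n.sqrt * (κ / Real.log 2 * n.sqrt)}
    refine le_trans ?_ (congrArg ENNReal.toReal h2).le
    -- Only monotonicity is used for the visit event, so the neighbourhoods need not be measurable.
    refine ENNReal.toReal_mono (measure_ne_top _ _) (measure_mono fun ω hω => ?_)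
    refine (hitCount_le_visitCount hUE (Nat.sqrt_le n) ω).trans (hω.trans ?_)
    have := mul_le_mul_of_nonneg_left hn4 (show 0 ≤ κ / Real.log 2 / 4 by positivity)
    linarith
  refine ⟨κ / Real.log 2 / 4, by positivity, fun β hβ => ?_⟩
  have hlim := (tendsto_rate_atTop (β := β) hκ0 hC hb hγ (2 * M)).eventually_le_const one_pos
  obtain ⟨L₀, hL₀⟩ := Filter.eventually_atTop.1 hlim
  -- Past `n₁` the square root exceeds both thresholds and the bound times `n ^ β` is at most 1.
  -- Below `n₁` the trivial bound 1 on the probability suffices with `d = n₁ ^ β`.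
  set n₁ := (L₀ + 2 * M + 1) * (L₀ + 2 * M + 1) with hn₁
  have hn₁1 : (1 : ℝ) ≤ n₁ := by exact_mod_cast Nat.mul_pos (by omega) (by omega)
  refine ⟨(n₁ : ℝ) ^ β, by positivity, fun n hn => ?_⟩
  have hn0 : (0 : ℝ) < n := by exact_mod_cast hn
  rw [le_div_iff₀ (by positivity)]
  rcases lt_or_ge n n₁ with h | h
  · calc _ ≤ 1 * (n : ℝ) ^ β := by gcongr; exact measureReal_le_one
      _ ≤ _ := by rw [one_mul]; gcongr
  · have hs : L₀ + 2 * M + 1 ≤ n.sqrt := Nat.le_sqrt.2 h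
    have hn4 : (n : ℝ) ≤ 4 * (n.sqrt : ℝ) ^ 2 := by
      have := Nat.sqrt_le_add n
      have h2 : n.sqrt ≤ n.sqrt * n.sqrt := Nat.le_mul_self _
      rw [sq]
      exact_mod_cast (by omega : n ≤ 4 * (n.sqrt * n.sqrt))
    refine le_trans ?_ (Real.one_le_rpow hn₁1 hβ.le)
    refine le_trans ?_ (hL₀ n.sqrt (by omega))
    rw [mul_comm]
    gcongr
    exact key n (by omega)
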